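/- Corollary 5.3. For a tree $T$ and a vertex $w$ of $T$, let $T(w)$ be the forest obtained by deleting $w$, and for a neighbor $v$ of $w$ let $T_v(w)$ be the connected component of $T(w)$ containing $v$. The property that a tree $T$ on $n$ vertices is NEB (nearly even branching) at $w$ is defined recursively: if $n=1$, then $T$ is NEB at $w$; if $n\ge 2$, then $T$ is NEB at $w$ when (i) $T(w)$ has exactly one component with an odd number of vertices if $n$ is even, and no such component if $n$ is odd, and (ii) for each neighbor $v$ of $w$, the tree $T_v(w)$ is NEB at $v$. For a graph $G$, let $S^-(G)$ be the set of real skew-symmetric matrices $A=[a_{i,j}]$, with rows and columns indexed by the vertices of $G$, such that for all $i\ne j$ one has $a_{i,j}\neq 0$ if and only if $\{i,j\}$ is an edge of $G$. Let $G$ be a connected graph on $n$ vertices, and let $\lambda_1,\dots,\lambda_n$ be distinct real numbers such that $\lambda_j=-\lambda_{n+1-j}$ for all $j=1,\dots,n$. If $G$ has a spanning tree which is NEB at some vertex, then the matching number of $G$ (the maximum number of edges in a matching of $G$) is $\lfloor n/2\rfloor$, and there exists a matrix $A\in S^-(G)$ with eigenvalues $\mathrm{i}\lambda_1,\dots,\mathrm{i}\lambda_n$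 (counted with multiplicity). -/

import Mathlib

universe u

namespace SkewNEB

/-- `T(w)`: the graph obtained from `T` by deleting the vertex `w`. -/
abbrev deleteVertex {V : Type u} (T : SimpleGraph V) (w : V) :
    SimpleGraph ({w}ᶜ : Set V) :=
  T.induce {w}ᶜ

/-- The connected component of `T(w)` that contains `v`, for a vertex `v` different from `w`. -/
abbrev branch {V : Type u} (T : SimpleGraph V) (w v : V) (h : v ≠ w) :
    (deleteVertex T w).ConnectedComponent :=
  (deleteVertex T w).connectedComponentMk ⟨v, h⟩

/-- `IsNEB T w`: the (finite) tree `T` has the nearly even branching property at the vertex `w`.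
A one-vertex tree has it. A tree on at least two vertices has it if the number of components of
`T(w)` with an odd number of vertices is `1` when `T` has an even number of vertices and `0` when
`T` has an odd number of vertices, and for each neighbour `v` of `w` the component `T_v(w)` of
`T(w)` containing `v` has the property at `v`.
(`oddComponents` is the set of connected components with an odd number of vertices.) -/
inductive IsNEB : {V : Type u} → SimpleGraph V → V → Prop
  | single {V : Type u} (T : SimpleGraph V) (w : V) (hcard : Nat.card V = 1) : IsNEB T w
  | step {V : Type u} (T : SimpleGraph V) (w : V) (hcard : 2 ≤ Nat.card V)
      (heven : Even (Nat.card V) → (deleteVertex T w).oddComponents.ncard = 1)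
      (hodd : Odd (Nat.card V) → (deleteVertex T w).oddComponents = ∅)
      (hbranch : ∀ (v : V) (h : T.Adj w v),
        IsNEB (branch T w v h.ne').toSimpleGraph ⟨⟨v, h.ne'⟩, rfl⟩) :
      IsNEB T w

/-- The matching number of a finite graph: the largest number of edges in a matching. -/
noncomputable def matchingNumber {V : Type u} (G : SimpleGraph V) : ℕ :=
  sSup {k : ℕ | ∃ M : G.Subgraph, M.IsMatching ∧ M.edgeSet.ncard = k}

/-- `S⁻(G)`: the real skew-symmetric matrices whose graph is `G`, that is, whose entry at two
distinct vertices `i`, `j` is nonzero exactly when `i` and `j` are adjacent. -/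
def skewMatrices {V : Type u} (G : SimpleGraph V) : Set (Matrix V V ℝ) :=
  {A | A.transpose = -A ∧ ∀ i j : V, i ≠ j → (G.Adj i j ↔ A i j ≠ 0)}

/-- The eigenvalues of a real square matrix: the multiset of complex roots of its characteristic
polynomial. -/
noncomputable def eigenvalues {V : Type u} [Fintype V] [DecidableEq V] (A : Matrix V V ℝ) :
    Multiset ℂ :=
  (A.map (fun x : ℝ => (x : ℂ))).charpoly.roots

end SkewNEB

/-! ### From the NEB property to a matching missing at most one vertex -/

namespace SkewNEB

open Function

/-! An NEB tree has a matching missing at most one vertex: recursively, delete `w`, match inside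
each component, and join `w` to the unmatched root of the odd component, if there is one
(`IsNEB.exists_isMatchingInvolution`). This settles the matching number.

For the spectrum, put the first `⌊n/2⌋` values `λ_j`, which are nonzero with distinct squares, as
weights `μ_j` on the matching edges. The resulting matrix has eigenvalues `±iλ_j`, and `0` at a
missed vertex. Now add `ε` times a skew matrix supported on the remaining edges. The equations
`det(λ_j I + iA) = 0` have, at `ε = 0`, an invertible diagonal Jacobian in the weights, so some
small `ε ≠ 0` admits weights, still nonzero, that solve them (`exists_skewMatrices_det_eq_zero`).
Skew-symmetry supplies the other half of the spectrum, and `0` when `n` is odd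
(`eigenvalues_eq_of_det_eq_zero`). -/

/-- `f` is an involution encoding a matching of `T` that misses no vertex except possibly `w`. -/
structure IsMatchingInvolution {V : Type*} (T : SimpleGraph V) (w : V) (f : V → V) : Prop where
  involutive : Involutive f
  adj : ∀ x, f x ≠ x → T.Adj x (f x)
  eq_of_fixed : ∀ x, f x = x → x = w

theorem card_fixedPoints_modEq_two {α : Type*} [Fintype α] [DecidableEq α] {f : α → α}
    (hf : Involutive f) :
    Fintype.card α ≡ Fintype.card (fixedPoints f) [MOD 2] :=
  Equiv.Perm.card_fixedPoints_modEq (f := (f : Function.End α)) (p := 2) (n := 1)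
    (by funext x; exact hf x)

/-- An involution moves points in pairs, so its fixed points have the parity of the whole set; here
only `w` can be fixed. -/
theorem IsMatchingInvolution.fixed_iff_odd {V : Type*} [Finite V] {T : SimpleGraph V} {w : V}
    {f : V → V} (hf : IsMatchingInvolution T w f) : f w = w ↔ Odd (Nat.card V) := by
  classical
  have := Fintype.ofFinite V
  have h := card_fixedPoints_modEq_two hf.involutive
  rw [Nat.card_eq_fintype_card]
  constructor
  · intro hw
    have : Fintype.card (fixedPoints f) = 1 :=
      Fintype.card_eq_one_iff.2 ⟨⟨w, hw⟩, fun y => Subtype.ext (hf.eq_of_fixed _ y.2)⟩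
    rw [this] at h
    exact Nat.odd_iff.2 h
  · intro ho
    by_contra hw
    have : Fintype.card (fixedPoints f) = 0 :=
      Fintype.card_eq_zero_iff.2 ⟨fun y => hw (by
        have := y.2
        rwa [hf.eq_of_fixed _ y.2] at this)⟩
    rw [this] at h
    have h1 := Nat.odd_iff.1 ho
    have h2 : Fintype.card V % 2 = 0 % 2 := h
    omega

/-- In a connected graph every component left after deleting `w` contains a neighbour of `w`. -/
theorem exists_adj_branch_eq {V : Type u} {T : SimpleGraph V} (hT : T.Connected) (w : V)
    (C : (deleteVertex T w).ConnectedComponent) :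
    ∃ (v : V) (h : T.Adj w v), branch T w v h.ne' = C := by
  induction C using SimpleGraph.ConnectedComponent.ind with | _ x
  obtain ⟨p⟩ := hT.preconnected x.1 w
  -- A walk from `x` to `w` leaves the component of `x` along some edge; that edge must end at `w`,
  -- since any other end would lie in the same component.
  obtain ⟨d, -, ⟨a, ha, hda⟩, hd⟩ := p.exists_boundary_dart
    (Subtype.val '' ((deleteVertex T w).connectedComponentMk x).supp) ⟨x, rfl, rfl⟩
    (by rintro ⟨y, -, hy⟩; exact y.2 hy)
  have hadj : T.Adj a.1 d.snd := by rw [hda]; exact d.adj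
  by_cases hw : d.snd = w
  · rw [hw] at hadj
    exact ⟨a.1, hadj.symm, ha⟩
  · refine (hd ⟨⟨d.snd, hw⟩, ?_, rfl⟩).elim
    have : (deleteVertex T w).Adj a ⟨d.snd, hw⟩ := hadj
    exact (SimpleGraph.ConnectedComponent.connectedComponentMk_eq_of_adj this).symm.trans ha

section Glue

variable {V : Type*} {G : SimpleGraph V} (f : ∀ C : G.ConnectedComponent, C → C)

/-- The self-map of the vertices that restricts to `f C` on each connected component `C`. -/
def glue (x : V) : V := (f (G.connectedComponentMk x) ⟨x, rfl⟩).1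

theorem glue_apply {C : G.ConnectedComponent} {x : V} (hx : x ∈ C.supp) :
    glue f x = (f C ⟨x, hx⟩).1 := by
  subst hx
  rfl

theorem involutive_glue (hf : ∀ C, Involutive (f C)) : Involutive (glue f) := by
  intro x
  rw [show glue f x = (f (G.connectedComponentMk x) ⟨x, rfl⟩).1 from rfl,
    glue_apply f (f (G.connectedComponentMk x) ⟨x, rfl⟩).2, hf]

theorem adj_glue (hf : ∀ C x, f C x ≠ x → C.toSimpleGraph.Adj x (f C x)) (x : V)
    (hx : glue f x ≠ x) : G.Adj x (glue f x) :=
  hf (G.connectedComponentMk x) ⟨x, rfl⟩ fun h => hx (congrArg Subtype.val h)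

end Glue

theorem IsNEB.exists_isMatchingInvolution {V : Type u} {T : SimpleGraph V} {w : V}
    (h : IsNEB T w) (hfin : Finite V) (hT : T.Connected) :
    ∃ f, IsMatchingInvolution T w f := by
  classical
  induction h with
  | single T w hcard =>
    have := (Nat.card_eq_one_iff_unique.1 hcard).1
    exact ⟨id, fun _ => rfl, fun x hx => (hx rfl).elim, fun x _ => Subsingleton.elim _ _⟩
  | @step V T w hcard heven hodd hbranch ih =>
    have key : ∀ C : (deleteVertex T w).ConnectedComponent, ∃ (v : ({w}ᶜ : Set V))
        (hv : v ∈ C.supp), T.Adj w v.1 ∧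
        ∃ f, IsMatchingInvolution C.toSimpleGraph ⟨v, hv⟩ f := by
      intro C
      obtain ⟨v, hv, rfl⟩ := exists_adj_branch_eq hT w C
      obtain ⟨f, hf⟩ := ih v hv inferInstance
        (SimpleGraph.ConnectedComponent.connected_toSimpleGraph _)
      exact ⟨⟨v, hv.ne'⟩, rfl, hv, f, hf⟩
    choose v hv hadj f hf using key
    have hinv := involutive_glue f fun C => (hf C).involutive
    have hgadj := adj_glue f fun C => (hf C).adj
    have hfix : ∀ x, glue f x = x →
        x = v ((deleteVertex T w).connectedComponentMk x) ∧
        (deleteVertex T w).connectedComponentMk x ∈ (deleteVertex T w).oddComponents := by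
      intro x hx
      have h1 : f ((deleteVertex T w).connectedComponentMk x) ⟨x, rfl⟩ = ⟨x, rfl⟩ :=
        Subtype.ext hx
      have h2 := (hf _).eq_of_fixed _ h1
      refine ⟨congrArg Subtype.val h2, ?_⟩
      rw [h2] at h1
      have := (hf _).fixed_iff_odd.1 h1
      exact this
    have hgv : ∀ C ∈ (deleteVertex T w).oddComponents, glue f (v C) = v C := by
      intro C hC
      have := (hf C).fixed_iff_odd.2 hC
      rw [glue_apply f (hv C), this]
    generalize glue f = g at hinv hgadj hfix hgv
    rcases Nat.even_or_odd (Nat.card V) with he | ho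
    · obtain ⟨C, hC⟩ := Set.ncard_eq_one.1 (heven he)
      have hCodd : C ∈ (deleteVertex T w).oddComponents := by rw [hC]; rfl
      have hvC : g (v C) = v C := hgv C hCodd
      have hne : (v C).1 ≠ w := (v C).2
      have hfixC : ∀ x, g x = x → x = v C := by
        intro x hx
        obtain ⟨h1, h2⟩ := hfix x hx
        rw [hC] at h2
        rw [h1, Set.mem_singleton_iff.1 h2]
      have hgne : ∀ x, x ≠ v C → g x ≠ v C := by
        intro x hx hx'
        exact hx (hinv.injective (hx'.trans hvC.symm))
      -- The root `v C` of the unique odd component is the only vertex left unmatched by `g`, so it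
      -- is paired with `w`.
      refine ⟨fun x => if hx : x = w then v C else if x = v C then w else g ⟨x, hx⟩,
        ?_, ?_, ?_⟩
      · intro x
        by_cases hx : x = w
        · simp [hx, hne]
        · by_cases hx' : x = v C
          · simp [hx', hne]
          · have h3 : (g ⟨x, hx⟩).1 ≠ w := (g ⟨x, hx⟩).2
            have h4 : (g ⟨x, hx⟩).1 ≠ v C := fun h =>
              hgne ⟨x, hx⟩ (fun h => hx' (congrArg Subtype.val h)) (Subtype.ext h)
            simp only [hx, hx', h3, h4, dite_false, if_false]
            exact congrArg Subtype.val (hinv ⟨x, hx⟩)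
      · intro x hfx
        by_cases hx : x = w
        · subst hx
          simpa using hadj C
        · by_cases hx' : x = v C
          · simpa [hx', hne] using (hadj C).symm
          · simp only [hx, hx', dite_false, if_false] at hfx ⊢
            exact hgadj ⟨x, hx⟩ fun h => hfx (congrArg Subtype.val h)
      · intro x hfx
        by_contra hx
        by_cases hx' : x = v C
        · simp only [hx', if_true] at hfx
          simp [hne] at hfx
          exact hne hfx.symm
        · simp only [hx, hx', dite_false, if_false] at hfx
          exact hx' (congrArg Subtype.val (hfixC ⟨x, hx⟩ (Subtype.ext hfx)))
    · refine ⟨fun x => if hx : x = w then w else g ⟨x, hx⟩, ?_, ?_, ?_⟩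
      · intro x
        by_cases hx : x = w
        · simp [hx]
        · have h3 : (g ⟨x, hx⟩).1 ≠ w := (g ⟨x, hx⟩).2
          simp only [hx, h3, dite_false]
          exact congrArg Subtype.val (hinv ⟨x, hx⟩)
      · intro x hfx
        by_cases hx : x = w
        · simp [hx] at hfx
        · simp only [hx, dite_false] at hfx ⊢
          exact hgadj ⟨x, hx⟩ fun h => hfx (congrArg Subtype.val h)
      · intro x hfx
        by_contra hx
        simp only [hx, dite_false] at hfx
        have := (hfix ⟨x, hx⟩ (Subtype.ext hfx)).2
        rw [hodd ho] at this
        exact this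

end SkewNEB

/-! ### A local surjectivity argument -/

namespace SkewNEB

open Function Matrix

/-- If `F` is `C¹`, vanishes at `(0, m)` and its derivative there in the second variable is
diagonal and invertible, then it has zeros near `(0, m)` off the hyperplane `ε = 0`. -/
theorem exists_zero_of_diagonal_fderiv {κ : Type*} [Fintype κ]
    {F : ℝ × (κ → ℝ) → κ → ℝ} (hF : ContDiff ℝ 1 F) {m : κ → ℝ} (h0 : F (0, m) = 0)
    (D : κ → ℝ) (hD : ∀ j, D j ≠ 0)
    (hder : ∀ j, HasFDerivAt (fun μ : κ → ℝ => F (0, μ) j)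
      (D j • (ContinuousLinearMap.proj j : (κ → ℝ) →L[ℝ] ℝ)) m)
    {U : Set (ℝ × (κ → ℝ))} (hU : U ∈ nhds (0, m)) :
    ∃ p ∈ U, p.1 ≠ 0 ∧ F p = 0 := by
  have hs : HasStrictFDerivAt F (fderiv ℝ F (0, m)) (0, m) :=
    hF.contDiffAt.hasStrictFDerivAt one_ne_zero
  set F' := fderiv ℝ F (0, m)
  have hdiag : ∀ (v : κ → ℝ) (j : κ), F' (0, v) j = D j * v j := by
    intro v j
    have h1 : HasFDerivAt (fun μ : κ → ℝ => F (0, μ))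
        (F'.comp (ContinuousLinearMap.inr ℝ ℝ (κ → ℝ))) m :=
      hs.hasFDerivAt.comp m (hasFDerivAt_prodMk_right 0 m)
    have h2 := (hasFDerivAt_pi'.1 h1 j).unique (hder j)
    simpa using DFunLike.congr_fun h2 v
  -- Keeping `ε` as a coordinate makes the derivative onto, so the map is open at `(0, m)`: the
  -- image of `U` contains `(ε, 0)` for all small `ε`, in particular for some nonzero one.
  have hΦ : HasStrictFDerivAt (fun p => (p.1, F p))
      ((ContinuousLinearMap.fst ℝ ℝ (κ → ℝ)).prod F') (0, m) :=
    hasStrictFDerivAt_fst.prodMk hs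
  have hsurj : ((ContinuousLinearMap.fst ℝ ℝ (κ → ℝ)).prod F').range = ⊤ := by
    refine LinearMap.range_eq_top.2 fun ⟨s, y⟩ => ⟨(s, fun j => (y j - F' (s, 0) j) / D j), ?_⟩
    refine Prod.ext rfl (funext fun j => ?_)
    have : ((s, fun j => (y j - F' (s, 0) j) / D j) : ℝ × (κ → ℝ)) =
        (s, 0) + (0, fun j => (y j - F' (s, 0) j) / D j) := by simp
    change F' (s, fun j => (y j - F' (s, 0) j) / D j) j = y j
    rw [this, map_add, Pi.add_apply, hdiag, mul_div_cancel₀ _ (hD j)]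
    ring
  have hmap := hΦ.map_nhds_eq_of_surj hsurj
  have himg : (fun p => (p.1, F p)) '' U ∈ nhds ((0 : ℝ), (0 : κ → ℝ)) := by
    have := Filter.image_mem_map (m := fun p => (p.1, F p)) hU
    rwa [hmap, h0] at this
  have hcont : Filter.Tendsto (fun ε : ℝ => (ε, (0 : κ → ℝ))) (nhdsWithin 0 {0}ᶜ)
      (nhds (0, 0)) :=
    ((Continuous.prodMk_left (0 : κ → ℝ)).tendsto 0).mono_left nhdsWithin_le_nhds
  obtain ⟨ε, ⟨p, hp, hpe⟩, hε⟩ :=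
    ((hcont.eventually himg).and self_mem_nhdsWithin).exists
  simp only [Prod.mk.injEq] at hpe
  exact ⟨p, hp, by rw [hpe.1]; exact hε, hpe.2⟩

end SkewNEB

/-! ### The matrix of a matching, and determinants of `xI + iA` -/

namespace SkewNEB

open Function Matrix Polynomial

section Pairing

variable {κ ρ : Type*} [DecidableEq κ]

/-- The skew-symmetric matrix of a matching with edges indexed by `κ`, unmatched vertices indexed
by `ρ` and edge weights `μ`. -/
noncomputable def pairingMatrix (ρ : Type*) (μ : κ → ℝ) :
    Matrix ((Fin 2 × κ) ⊕ ρ) ((Fin 2 × κ) ⊕ ρ) ℝ :=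
  fromBlocks (blockDiagonal fun l => !![0, μ l; -μ l, 0]) 0 0 0

theorem transpose_pairingMatrix (μ : κ → ℝ) :
    (pairingMatrix ρ μ).transpose = -pairingMatrix ρ μ := by
  ext i j
  rcases i with ⟨a, l⟩ | i <;> rcases j with ⟨b, m⟩ | j <;>
    simp [pairingMatrix, blockDiagonal_apply]
  by_cases h : l = m
  · subst h
    fin_cases a <;> fin_cases b <;> simp
  · simp [h, Ne.symm h]

theorem det_smul_one_add_pairingMatrix [Fintype κ] [Fintype ρ] [DecidableEq ρ] (μ : κ → ℝ) (x : ℝ) :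
    det ((x : ℂ) • (1 : Matrix ((Fin 2 × κ) ⊕ ρ) ((Fin 2 × κ) ⊕ ρ) ℂ) +
      Complex.I • (pairingMatrix ρ μ).map (fun y : ℝ => (y : ℂ))) =
      (((∏ l, (x ^ 2 - μ l ^ 2)) * x ^ Fintype.card ρ : ℝ) : ℂ) := by
  have h : (x : ℂ) • (1 : Matrix ((Fin 2 × κ) ⊕ ρ) ((Fin 2 × κ) ⊕ ρ) ℂ) +
      Complex.I • (pairingMatrix ρ μ).map (fun y : ℝ => (y : ℂ)) =
      fromBlocks (blockDiagonal fun l => !![(x : ℂ), Complex.I * μ l; -(Complex.I * μ l), x])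
        0 0 ((x : ℂ) • 1) := by
    ext i j
    rcases i with ⟨a, l⟩ | i <;> rcases j with ⟨b, m⟩ | j <;>
      simp [pairingMatrix, blockDiagonal_apply, one_apply]
    by_cases h : l = m
    · subst h
      fin_cases a <;> fin_cases b <;> simp
    · simp [h]
  rw [h, det_fromBlocks_zero₂₁, det_blockDiagonal]
  simp only [det_fin_two_of, det_smul, det_one, mul_one]
  push_cast
  congr 1
  refine Finset.prod_congr rfl fun l _ => ?_
  linear_combination (μ l : ℂ) ^ 2 * Complex.I_sq

theorem contDiff_pairingMatrix_apply [Fintype κ] (i j : (Fin 2 × κ) ⊕ ρ) :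
    ContDiff ℝ 1 fun μ : κ → ℝ => pairingMatrix ρ μ i j := by
  rcases i with ⟨a, l⟩ | i <;> rcases j with ⟨b, m⟩ | j <;>
    simp only [pairingMatrix, fromBlocks_apply₁₁, fromBlocks_apply₁₂, fromBlocks_apply₂₁,
      fromBlocks_apply₂₂, Matrix.zero_apply, contDiff_const, blockDiagonal_apply]
  by_cases h : l = m
  · fin_cases a <;> fin_cases b <;> simp [h] <;> fun_prop
  · simp [h, contDiff_const]

/-- The zero pattern does not depend on the nonzero weights, so weight `1` can serve as the
reference pattern. -/
theorem pairingMatrix_apply_ne_zero_iff {μ : κ → ℝ} (hμ : ∀ l, μ l ≠ 0)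
    (i j : (Fin 2 × κ) ⊕ ρ) :
    pairingMatrix ρ μ i j ≠ 0 ↔ pairingMatrix ρ (1 : κ → ℝ) i j ≠ 0 := by
  rcases i with ⟨a, l⟩ | i <;> rcases j with ⟨b, m⟩ | j <;>
    simp [pairingMatrix, blockDiagonal_apply]
  by_cases h : l = m
  · subst h
    fin_cases a <;> fin_cases b <;> simp [hμ]
  · simp [h]

theorem adj_of_pairingMatrix_ne_zero {H : SimpleGraph ((Fin 2 × κ) ⊕ ρ)}
    (hH : ∀ l, H.Adj (Sum.inl (0, l)) (Sum.inl (1, l))) {i j : (Fin 2 × κ) ⊕ ρ}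
    (hij : pairingMatrix ρ (1 : κ → ℝ) i j ≠ 0) : H.Adj i j := by
  revert hij
  rcases i with ⟨a, l⟩ | i <;> rcases j with ⟨b, m⟩ | j <;>
    simp [pairingMatrix, blockDiagonal_apply]
  intro h
  subst h
  fin_cases a <;> fin_cases b <;> simp [hH, (hH _).symm]

end Pairing

section Spectrum

variable {W : Type*} [Fintype W] [DecidableEq W]

/-- Because `i(xI + iA) = ixI - A`. -/
theorem eval_charpoly_I_mul (A : Matrix W W ℝ) (x : ℝ) :
    (A.map (fun y : ℝ => (y : ℂ))).charpoly.eval (Complex.I * x) =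
      Complex.I ^ Fintype.card W *
        det ((x : ℂ) • (1 : Matrix W W ℂ) + Complex.I • A.map (fun y : ℝ => (y : ℂ))) := by
  rw [eval_charpoly, ← det_smul]
  congr 1
  ext i j
  by_cases h : i = j
  · subst h
    simp only [Matrix.sub_apply, scalar_apply, diagonal_apply_eq, map_apply, Matrix.smul_apply, Matrix.add_apply,
      one_apply_eq, smul_eq_mul, mul_one]
    linear_combination -(A i i : ℂ) * Complex.I_sq
  · simp only [Matrix.sub_apply, scalar_apply, diagonal_apply_ne _ h, map_apply, Matrix.smul_apply, Matrix.add_apply,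
      one_apply_ne h, smul_eq_mul, mul_zero]
    linear_combination -(A i j : ℂ) * Complex.I_sq

/-- The transpose of `-xI + iA` is `-(xI + iA)`. -/
theorem det_smul_one_add_neg {A : Matrix W W ℝ} (hA : A.transpose = -A) (x : ℝ) :
    det (((-x : ℝ) : ℂ) • (1 : Matrix W W ℂ) + Complex.I • A.map (fun y : ℝ => (y : ℂ))) =
      (-1) ^ Fintype.card W *
        det ((x : ℂ) • (1 : Matrix W W ℂ) + Complex.I • A.map (fun y : ℝ => (y : ℂ))) := by
  rw [← det_transpose, ← det_smul]
  congr 1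
  ext i j
  have h : A j i = -A i j := congrFun (congrFun hA i) j
  simp [one_apply, h, eq_comm (a := i)]
  ring

/-- The matrix `xI + iA` is Hermitian. Hence real parts of these determinants give real equations
without losing information. -/
theorem det_smul_one_add_re {A : Matrix W W ℝ} (hA : A.transpose = -A) (x : ℝ) :
    ((det ((x : ℂ) • (1 : Matrix W W ℂ) + Complex.I • A.map (fun y : ℝ => (y : ℂ)))).re : ℂ) =
      det ((x : ℂ) • (1 : Matrix W W ℂ) + Complex.I • A.map (fun y : ℝ => (y : ℂ))) := by
  rw [← Complex.conj_eq_iff_re]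
  change star _ = _
  rw [← det_conjTranspose]
  congr 1
  ext i j
  have h : A j i = -A i j := congrFun (congrFun hA i) j
  simp [one_apply, h, eq_comm (a := i), conjTranspose_apply]
  split_ifs <;> simp

end Spectrum

end SkewNEB

/-! ### Perturbing the matching matrix, and recovering the full spectrum -/

namespace SkewNEB

open Function Matrix

/-- Placing any nonzero numbers with distinct squares on a near-perfect matching of `H`, the
remaining entries can be made nonzero while keeping these numbers as eigenvalues (up to `i`). -/
theorem exists_skewMatrices_det_eq_zero {κ ρ : Type u} [Fintype κ] [DecidableEq κ] [Fintype ρ]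
    [DecidableEq ρ] {H : SimpleGraph ((Fin 2 × κ) ⊕ ρ)}
    (hH : ∀ l, H.Adj (Sum.inl (0, l)) (Sum.inl (1, l))) {m : κ → ℝ} (hm : ∀ l, m l ≠ 0)
    (hsq : Injective fun l => m l ^ 2) :
    ∃ A ∈ skewMatrices H, ∀ j, det ((m j : ℂ) • (1 : Matrix _ _ ℂ) +
      Complex.I • A.map (fun y : ℝ => (y : ℂ))) = 0 := by
  classical
  let e := Fintype.equivFin ((Fin 2 × κ) ⊕ ρ)
  -- `B` carries `±1` on the edges outside the matching; the enumeration `e` only serves to choose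
  -- signs skew-symmetrically.
  let B : Matrix ((Fin 2 × κ) ⊕ ρ) ((Fin 2 × κ) ⊕ ρ) ℝ := fun i j =>
    if H.Adj i j ∧ pairingMatrix ρ (1 : κ → ℝ) i j = 0 then (if e i < e j then 1 else -1) else 0
  have hpair_symm : ∀ (μ : κ → ℝ) i j, pairingMatrix ρ μ j i = -pairingMatrix ρ μ i j :=
    fun μ i j => congrFun (congrFun (transpose_pairingMatrix μ) i) j
  have hBskew : ∀ i j, B j i = -B i j := by
    intro i j
    simp only [B, H.adj_comm j i, hpair_symm 1 i j, neg_eq_zero]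
    by_cases h : H.Adj i j ∧ pairingMatrix ρ (1 : κ → ℝ) i j = 0
    · have hne : e i ≠ e j := fun h' => h.1.ne (e.injective h')
      rw [if_pos h, if_pos h]
      rcases lt_or_gt_of_ne hne with h' | h'
      · simp [h', h'.not_gt]
      · simp [h', h'.not_gt]
    · rw [if_neg h, if_neg h, neg_zero]
  let A : ℝ × (κ → ℝ) → Matrix ((Fin 2 × κ) ⊕ ρ) ((Fin 2 × κ) ⊕ ρ) ℝ := fun p =>
    pairingMatrix ρ p.2 + p.1 • B
  have hAapply : ∀ p i j, A p i j = pairingMatrix ρ p.2 i j + p.1 * B i j := fun _ _ _ => rfl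
  have hAskew : ∀ p, (A p).transpose = -A p := by
    intro p
    ext i j
    rw [transpose_apply, Matrix.neg_apply, hAapply, hAapply, hpair_symm p.2 i j, hBskew i j]
    ring
  have hAmem : ∀ p, p.1 ≠ 0 → (∀ l, p.2 l ≠ 0) → A p ∈ skewMatrices H := by
    intro p hp hp'
    refine ⟨hAskew p, fun i j hij => ?_⟩
    have h1 := pairingMatrix_apply_ne_zero_iff (ρ := ρ) hp' i j
    by_cases h : pairingMatrix ρ (1 : κ → ℝ) i j = 0
    · have h2 : pairingMatrix ρ p.2 i j = 0 := by
        by_contra h3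
        exact h1.1 h3 h
      rw [hAapply, h2, zero_add]
      by_cases hadj : H.Adj i j
      · have hB : B i j ≠ 0 := by
          simp only [B, if_pos (show H.Adj i j ∧ _ from ⟨hadj, h⟩)]
          split_ifs <;> norm_num
        exact iff_of_true hadj (mul_ne_zero hp hB)
      · have hB : B i j = 0 := if_neg fun h => hadj h.1
        simp [hB, hadj]
    · have hB : B i j = 0 := if_neg fun h' => h h'.2
      rw [hAapply, hB, mul_zero, add_zero]
      exact iff_of_true (adj_of_pairingMatrix_ne_zero hH h) (h1.2 h)
  let F : ℝ × (κ → ℝ) → κ → ℝ := fun p j => (det ((m j : ℂ) • (1 : Matrix _ _ ℂ) +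
      Complex.I • (A p).map (fun y : ℝ => (y : ℂ)))).re
  have hF : ContDiff ℝ 1 F := by
    refine contDiff_pi.2 fun j => Complex.reCLM.contDiff.comp ?_
    simp only [det_apply]
    refine ContDiff.sum fun σ _ => ContDiff.const_smul _ (contDiff_prod fun i _ => ?_)
    simp only [Matrix.add_apply, Matrix.smul_apply, map_apply, hAapply]
    refine contDiff_const.add (ContDiff.const_smul _ (Complex.ofRealCLM.contDiff.comp
      (f := fun p : ℝ × (κ → ℝ) => pairingMatrix ρ p.2 (σ i) i + p.1 * B (σ i) i) ?_))
    exact ((contDiff_pairingMatrix_apply _ _).comp contDiff_snd).add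
      (contDiff_fst.mul contDiff_const)
  have hF0 : ∀ (μ : κ → ℝ) j,
      F (0, μ) j = (∏ l, (m j ^ 2 - μ l ^ 2)) * m j ^ Fintype.card ρ := by
    intro μ j
    have : A (0, μ) = pairingMatrix ρ μ := by simp [A]
    simp only [F, this, det_smul_one_add_pairingMatrix, Complex.ofReal_re]
  have hm0 : F (0, m) = 0 := by
    funext j
    rw [hF0, Finset.prod_eq_zero (Finset.mem_univ j) (sub_self _), zero_mul]
    rfl
  -- At `μ = m` the factor `m j ^ 2 - μ j ^ 2` vanishes, so only its own derivative survives in the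
  -- product rule; the cofactor is nonzero because the squares are distinct.
  let D : κ → ℝ := fun j =>
    -2 * m j * ((∏ l ∈ Finset.univ.erase j, (m j ^ 2 - m l ^ 2)) * m j ^ Fintype.card ρ)
  have hD : ∀ j, D j ≠ 0 := by
    intro j
    refine mul_ne_zero (mul_ne_zero (by norm_num) (hm j))
      (mul_ne_zero (Finset.prod_ne_zero_iff.2 fun l hl => ?_) (pow_ne_zero _ (hm j)))
    exact sub_ne_zero.2 fun h => (Finset.ne_of_mem_erase hl) (hsq h).symm
  have hder : ∀ j, HasFDerivAt (fun μ : κ → ℝ => F (0, μ) j)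
      (D j • (ContinuousLinearMap.proj j : (κ → ℝ) →L[ℝ] ℝ)) m := by
    intro j
    have hfun : (fun μ : κ → ℝ => F (0, μ) j) = fun μ => (m j ^ 2 - μ j ^ 2) *
        ((∏ l ∈ Finset.univ.erase j, (m j ^ 2 - μ l ^ 2)) * m j ^ Fintype.card ρ) := by
      funext μ
      rw [hF0, ← Finset.mul_prod_erase _ _ (Finset.mem_univ j), mul_assoc]
    have hR : DifferentiableAt ℝ (fun μ : κ → ℝ =>
        (∏ l ∈ Finset.univ.erase j, (m j ^ 2 - μ l ^ 2)) * m j ^ Fintype.card ρ) m := by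
      have : ContDiff ℝ 1 (fun μ : κ → ℝ =>
          (∏ l ∈ Finset.univ.erase j, (m j ^ 2 - μ l ^ 2)) * m j ^ Fintype.card ρ) :=
        (contDiff_prod fun l _ => by fun_prop).mul contDiff_const
      exact (this.differentiable one_ne_zero).differentiableAt
    have hL : HasFDerivAt (fun μ : κ → ℝ => m j ^ 2 - μ j ^ 2)
        (-((2 * m j) • (ContinuousLinearMap.proj j : (κ → ℝ) →L[ℝ] ℝ))) m := by
      simpa using ((ContinuousLinearMap.proj (R := ℝ) (φ := fun _ : κ => ℝ)
        j).hasFDerivAt (x := m)).pow 2 |>.const_sub (m j ^ 2)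
    rw [hfun]
    refine (hL.mul hR.hasFDerivAt).congr_fderiv ?_
    ext v
    simp [D]
    ring
  have hU : {p : ℝ × (κ → ℝ) | ∀ l, p.2 l ≠ 0} ∈ nhds ((0 : ℝ), m) := by
    simp only [Set.ofPred_forall]
    refine Filter.iInter_mem.2 fun l => ?_
    exact (((continuous_apply l).comp continuous_snd).continuousAt.eventually_ne (hm l))
  obtain ⟨p, hpU, hp, hFp⟩ := exists_zero_of_diagonal_fderiv hF hm0 D hD hder hU
  refine ⟨A p, hAmem p hp hpU, fun j => ?_⟩
  rw [← det_smul_one_add_re (hAskew p), Complex.ofReal_eq_zero]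
  exact congrFun hFp j

/-- A skew-symmetric matrix whose spectrum contains `i` times the first half of a symmetric list
of distinct reals has exactly `i` times that list as its spectrum. -/
theorem eigenvalues_eq_of_det_eq_zero {V : Type u} [Fintype V] [DecidableEq V]
    {A : Matrix V V ℝ} (hA : A.transpose = -A) {n : ℕ} (hn : Fintype.card V = n)
    {lam : Fin n → ℝ} (hdistinct : Injective lam) (hsymm : ∀ j : Fin n, lam j = -lam j.rev)
    (hdet : ∀ j : Fin n, j.1 < n / 2 → det ((lam j : ℂ) • (1 : Matrix V V ℂ) +
      Complex.I • A.map (fun y : ℝ => (y : ℂ))) = 0) :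
    eigenvalues A =
      (Finset.univ : Finset (Fin n)).val.map (fun j => Complex.I * (lam j : ℂ)) := by
  have hall : ∀ j : Fin n, det ((lam j : ℂ) • (1 : Matrix V V ℂ) +
      Complex.I • A.map (fun y : ℝ => (y : ℂ))) = 0 := by
    intro j
    by_cases h1 : j.1 < n / 2
    · exact hdet j h1
    by_cases h2 : j.rev.1 < n / 2
    · rw [hsymm j, det_smul_one_add_neg hA, hdet _ h2, mul_zero]
    · rw [Fin.val_rev] at h2
      have hj := j.2
      have hrev : j.rev = j := Fin.ext (by rw [Fin.val_rev]; omega)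
      have hodd : Odd (Fintype.card V) := by
        rw [hn, Nat.odd_iff]
        omega
      have h0 : lam j = 0 := by
        have := hsymm j
        rw [hrev] at this
        linarith
      -- The middle index of an odd list: the value is `0`, and a skew-symmetric matrix of odd order
      -- is singular.
      have h3 := det_smul_one_add_neg hA (lam j)
      rw [hodd.neg_one_pow, h0, neg_zero] at h3
      rw [h0]
      linear_combination h3 / 2
  have hmonic := (A.map (fun y : ℝ => (y : ℂ))).charpoly_monic
  have hnodup : ((Finset.univ : Finset (Fin n)).val.map
      (fun j => Complex.I * (lam j : ℂ))).Nodup := by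
    refine Multiset.Nodup.map (fun i j h => hdistinct ?_) Finset.univ.nodup
    exact Complex.ofReal_injective (mul_left_cancel₀ Complex.I_ne_zero h)
  symm
  -- There are `n` distinct roots of a polynomial of degree `n`, so there are no others and all are
  -- simple.
  refine Multiset.eq_of_le_of_card_le ((Multiset.le_iff_subset hnodup).2 fun z hz => ?_) ?_
  · obtain ⟨j, -, rfl⟩ := Multiset.mem_map.1 hz
    refine (Polynomial.mem_roots hmonic.ne_zero).2 ?_
    rw [Polynomial.IsRoot, eval_charpoly_I_mul, hall, mul_zero]
  · refine (Polynomial.card_roots' _).trans ?_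
    rw [charpoly_natDegree_eq_dim, hn]
    simp

/-- Reindexing carries `S⁻` of the pulled back graph to `S⁻` of the graph. -/
theorem reindex_mem_skewMatrices {W V : Type u} (e : W ≃ V) {G : SimpleGraph V}
    {A : Matrix W W ℝ} (hA : A ∈ skewMatrices (G.comap e)) :
    A.reindex e e ∈ skewMatrices G := by
  refine ⟨?_, fun i j hij => ?_⟩
  · ext i j
    exact congrFun (congrFun hA.1 (e.symm i)) (e.symm j)
  · have := hA.2 (e.symm i) (e.symm j) (e.symm.injective.ne hij)
    simpa using this

theorem det_smul_one_add_reindex {W V : Type*} [Fintype W] [DecidableEq W] [Fintype V]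
    [DecidableEq V] (e : W ≃ V) (A : Matrix W W ℝ) (x : ℂ) :
    det (x • (1 : Matrix V V ℂ) + Complex.I • (A.reindex e e).map (fun y : ℝ => (y : ℂ))) =
      det (x • (1 : Matrix W W ℂ) + Complex.I • A.map (fun y : ℝ => (y : ℂ))) := by
  rw [← det_reindex_self e]
  congr 1
  ext i j
  simp [one_apply]

end SkewNEB

/-! ### Parametrized matchings and the conclusion -/

namespace SkewNEB

open Function

/-- A matching missing at most one vertex, as a parametrization of the vertex set. -/
structure MatchingParam {V : Type u} (G : SimpleGraph V) (κ ρ : Type u) where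
  /-- The two ends of each edge of the matching, and the missed vertices. -/
  equiv : (Fin 2 × κ) ⊕ ρ ≃ V
  adj : ∀ l, G.Adj (equiv (Sum.inl (0, l))) (equiv (Sum.inl (1, l)))
  subsingleton : Subsingleton ρ

theorem IsMatchingInvolution.exists_matchingParam {V : Type u} [Finite V] {T : SimpleGraph V}
    {w : V} {f : V → V} (hf : IsMatchingInvolution T w f) :
    ∃ κ ρ : Type u, Nonempty (MatchingParam T κ ρ) := by
  classical
  have := Fintype.ofFinite V
  -- An arbitrary order singles out one end of each pair `{x, f x}`, the smaller, to index the edge.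
  let : LinearOrder V := LinearOrder.lift' (Fintype.equivFin V) (Fintype.equivFin V).injective
  let g : (Fin 2 × {x // x < f x}) ⊕ {x // f x = x} → V :=
    Sum.elim (fun p => if p.1 = 0 then p.2.1 else f p.2.1) Subtype.val
  have hff := hf.involutive
  have hg : Bijective g := by
    constructor
    · rintro (⟨a, x, hx⟩ | ⟨x, hx⟩) (⟨b, y, hy⟩ | ⟨y, hy⟩) h
      · fin_cases a <;> fin_cases b <;> simp [g] at h ⊢
        · exact h
        · subst h
          rw [hff y] at hx
          exact lt_asymm hx hy
        · subst h
          rw [hff x] at hy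
          exact lt_asymm hx hy
        · exact hff.injective h
      · fin_cases a <;> simp [g] at h
        · subst h
          exact absurd hy hx.ne'
        · subst h
          rw [hff x] at hy
          exact absurd hy hx.ne
      · fin_cases b <;> simp [g] at h
        · subst h
          exact absurd hx hy.ne'
        · subst h
          rw [hff y] at hx
          exact absurd hx hy.ne
      · simp [g] at h ⊢
        exact h
    · intro x
      rcases lt_trichotomy x (f x) with h | h | h
      · exact ⟨Sum.inl (0, ⟨x, h⟩), by simp [g]⟩
      · exact ⟨Sum.inr ⟨x, h.symm⟩, rfl⟩
      · exact ⟨Sum.inl (1, ⟨f x, by rwa [hff x]⟩), by simp [g, hff x]⟩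
  refine ⟨_, _, ⟨⟨Equiv.ofBijective g hg, fun l => ?_, ⟨fun x y => Subtype.ext ?_⟩⟩⟩⟩
  · simpa [g] using hf.adj l.1 l.2.ne'
  · rw [hf.eq_of_fixed _ x.2, hf.eq_of_fixed _ y.2]

/-- The same matching in a larger graph. -/
def MatchingParam.mono {V : Type u} {G G' : SimpleGraph V} {κ ρ : Type u}
    (P : MatchingParam G κ ρ) (h : G ≤ G') : MatchingParam G' κ ρ :=
  ⟨P.equiv, fun l => h (P.adj l), P.subsingleton⟩

theorem MatchingParam.card_eq {V : Type u} [Finite V] {G : SimpleGraph V} {κ ρ : Type u}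
    [Finite κ] (P : MatchingParam G κ ρ) : Nat.card κ = Nat.card V / 2 := by
  have := P.subsingleton
  have h := Nat.card_congr P.equiv
  rw [Nat.card_sum, Nat.card_prod, Nat.card_fin] at h
  have := Finite.card_le_one_iff_subsingleton.2 this
  omega

/-- Degrees in a matching are at most one, and they sum to twice the number of edges. -/
theorem two_mul_ncard_edgeSet_le {V : Type u} [Finite V] {G : SimpleGraph V} {M : G.Subgraph}
    (hM : M.IsMatching) : 2 * M.edgeSet.ncard ≤ Nat.card V := by
  classical
  have := Fintype.ofFinite V
  have h := M.spanningCoe.sum_degrees_eq_twice_card_edges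
  have hE : M.edgeSet.ncard = M.spanningCoe.edgeFinset.card := by
    rw [← Set.ncard_coe_finset, SimpleGraph.coe_edgeFinset]
    rfl
  rw [hE, ← h, Nat.card_eq_fintype_card, ← Finset.card_univ, Finset.card_eq_sum_ones]
  refine Finset.sum_le_sum fun v _ => ?_
  rw [← SimpleGraph.card_neighborFinset_eq_degree, Finset.card_le_one]
  intro a ha b hb
  rw [SimpleGraph.mem_neighborFinset] at ha hb
  exact hM.eq_of_adj_left ha hb

theorem MatchingParam.exists_isMatching {V : Type u} {G : SimpleGraph V} {κ ρ : Type u}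
    (P : MatchingParam G κ ρ) :
    ∃ M : G.Subgraph, M.IsMatching ∧ M.edgeSet.ncard = Nat.card κ := by
  let u : κ → V := fun l => P.equiv (Sum.inl (0, l))
  let v : κ → V := fun l => P.equiv (Sum.inl (1, l))
  have hu : Injective u := fun l m h => by simpa [u] using h
  have hv : Injective v := fun l m h => by simpa [v] using h
  have huv : ∀ l m, u l ≠ v m := fun l m h => by simp [u, v] at h
  let M : G.Subgraph :=
    { verts := {x | ∃ l, x = u l ∨ x = v l}
      Adj := fun x y => ∃ l, (x = u l ∧ y = v l) ∨ (x = v l ∧ y = u l)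
      adj_sub := by
        rintro x y ⟨l, ⟨rfl, rfl⟩ | ⟨rfl, rfl⟩⟩
        · exact P.adj l
        · exact (P.adj l).symm
      edge_vert := by
        rintro x y ⟨l, ⟨rfl, rfl⟩ | ⟨rfl, rfl⟩⟩
        · exact ⟨l, Or.inl rfl⟩
        · exact ⟨l, Or.inr rfl⟩
      symm := ⟨by
        rintro x y ⟨l, ⟨rfl, rfl⟩ | ⟨rfl, rfl⟩⟩
        · exact ⟨l, Or.inr ⟨rfl, rfl⟩⟩
        · exact ⟨l, Or.inl ⟨rfl, rfl⟩⟩⟩ }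
  refine ⟨M, ?_, ?_⟩
  · rintro x ⟨l, rfl | rfl⟩
    · refine ⟨v l, ⟨l, Or.inl ⟨rfl, rfl⟩⟩, ?_⟩
      rintro y ⟨m, ⟨h, rfl⟩ | ⟨h, rfl⟩⟩
      · rw [hu h]
      · exact (huv _ _ h).elim
    · refine ⟨u l, ⟨l, Or.inr ⟨rfl, rfl⟩⟩, ?_⟩
      rintro y ⟨m, ⟨h, rfl⟩ | ⟨h, rfl⟩⟩
      · exact (huv _ _ h.symm).elim
      · rw [hv h]
  · have hset : M.edgeSet = Set.range fun l => s(u l, v l) := by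
      ext z
      induction z using Sym2.ind with | _ x y
      constructor
      · rintro ⟨l, ⟨rfl, rfl⟩ | ⟨rfl, rfl⟩⟩
        · exact ⟨l, rfl⟩
        · exact ⟨l, Sym2.eq_swap⟩
      · rintro ⟨l, h⟩
        rcases Sym2.eq_iff.1 h with ⟨rfl, rfl⟩ | ⟨rfl, rfl⟩
        · exact ⟨l, Or.inl ⟨rfl, rfl⟩⟩
        · exact ⟨l, Or.inr ⟨rfl, rfl⟩⟩
    rw [hset, ← Set.image_univ, Set.ncard_image_of_injective, Set.ncard_univ]
    intro l m h
    rcases Sym2.eq_iff.1 h with ⟨h, -⟩ | ⟨h, -⟩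
    · exact hu h
    · exact (huv _ _ h).elim

theorem MatchingParam.matchingNumber_eq {V : Type u} [Finite V] {G : SimpleGraph V}
    {κ ρ : Type u} [Finite κ] (P : MatchingParam G κ ρ) :
    matchingNumber G = Nat.card V / 2 := by
  refine IsGreatest.csSup_eq ⟨?_, ?_⟩
  · rw [← P.card_eq]
    exact P.exists_isMatching
  · rintro k ⟨M, hM, rfl⟩
    have := two_mul_ncard_edgeSet_le hM
    omega

theorem MatchingParam.exists_eigenvalues_eq {V : Type u} [Fintype V] [DecidableEq V]
    {G : SimpleGraph V} {κ ρ : Type u} [Finite κ] [Finite ρ] (P : MatchingParam G κ ρ) {n : ℕ}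
    (hn : Fintype.card V = n) {lam : Fin n → ℝ} (hdistinct : Injective lam)
    (hsymm : ∀ j : Fin n, lam j = -lam j.rev) :
    ∃ A ∈ skewMatrices G, eigenvalues A =
      (Finset.univ : Finset (Fin n)).val.map (fun j => Complex.I * (lam j : ℂ)) := by
  classical
  have := Fintype.ofFinite κ
  have := Fintype.ofFinite ρ
  have hcard : Nat.card κ = n / 2 := by rw [P.card_eq, Nat.card_eq_fintype_card, hn]
  let q : κ ≃ Fin (n / 2) := (Finite.equivFin κ).trans (finCongr hcard)
  let ι : κ → Fin n := fun l => ⟨q l, (q l).2.trans_le (Nat.div_le_self n 2)⟩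
  have hι : Injective ι := fun l m h => q.injective (Fin.ext (Fin.mk.inj h))
  -- Equality would force the indices to sum to `n - 1`, impossible when both are below `n / 2`.
  -- This gives both nonvanishing (`l = m`) and distinct squares.
  have hne : ∀ l m, lam (ι l) ≠ -lam (ι m) := by
    intro l m h
    have h1 := hsymm (ι m).rev
    rw [Fin.rev_rev, ← h] at h1
    have h2 := congrArg Fin.val (hdistinct h1)
    rw [Fin.val_rev] at h2
    have hl : (ι l).1 < n / 2 := (q l).2
    have hm : (ι m).1 < n / 2 := (q m).2
    omega
  obtain ⟨A, hA, hdet⟩ := exists_skewMatrices_det_eq_zero (H := G.comap P.equiv)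
    (m := fun l => lam (ι l)) P.adj
    (fun l h => hne l l (by rw [h, neg_zero]))
    (fun l m h => (sq_eq_sq_iff_eq_or_eq_neg.1 h).elim (fun h => hι (hdistinct h))
      fun h => (hne l m h).elim)
  have hB := reindex_mem_skewMatrices P.equiv hA
  refine ⟨_, hB, eigenvalues_eq_of_det_eq_zero hB.1 hn hdistinct hsymm fun j hj => ?_⟩
  have hj' : ι (q.symm ⟨j, hj⟩) = j := by simp [ι]
  rw [det_smul_one_add_reindex, ← hj']
  exact hdet _

end SkewNEB

theorem corollary5p3 {V : Type u} [Fintype V] [DecidableEq V] (G : SimpleGraph V)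
    (hG : G.Connected) (n : ℕ) (hn : Fintype.card V = n)
    (lam : Fin n → ℝ) (hdistinct : Function.Injective lam)
    (hsymm : ∀ j : Fin n, lam j = -lam j.rev)
    (hT : ∃ T : SimpleGraph V, T ≤ G ∧ T.IsTree ∧ ∃ w : V, SkewNEB.IsNEB T w) :
    SkewNEB.matchingNumber G = n / 2 ∧
      ∃ A ∈ SkewNEB.skewMatrices G,
        SkewNEB.eigenvalues A =
          (Finset.univ : Finset (Fin n)).val.map (fun j => Complex.I * (lam j : ℂ)) := by
  obtain ⟨T, hTG, hT, w, hw⟩ := hT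
  obtain ⟨f, hf⟩ := hw.exists_isMatchingInvolution inferInstance hT.connected
  obtain ⟨κ, ρ, ⟨P⟩⟩ := hf.exists_matchingParam
  have hfin : Finite ((Fin 2 × κ) ⊕ ρ) := Finite.of_equiv V P.equiv.symm
  have : Finite κ := Finite.of_injective (fun l : κ => (Sum.inl (0, l) : (Fin 2 × κ) ⊕ ρ))
    fun l m h => by simpa using h
  have : Finite ρ := Finite.of_injective (Sum.inr : ρ → (Fin 2 × κ) ⊕ ρ) Sum.inr_injective
  have P' := P.mono hTG
  exact ⟨by rw [P'.matchingNumber_eq, Nat.card_eq_fintype_card, hn],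
    P'.exists_eigenvalues_eq hn hdistinct hsymm⟩
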